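/- Let $X$ be a compact connected Riemann surface of genus $g \ge 2$, where $g = \dim_{\mathbb C} H^0(X, K_X)$ is the dimension of the space of holomorphic $1$-forms on $X$. For $n \ge 1$ let $X^n$ be the $n$-fold Cartesian product, with holomorphic tangent bundle $TX^n$, and for $1 \le j < k \le n$ let $\Delta_{j,k} \subset X^n$ be the divisor of points whose $j$-th and $k$-th coordinates coincide. Then for every $n \ge 1$ and all integers $m_{j,k} \ge 0$ ($1 \le j < k \le n$), $$H^0\Bigl(X^n,\ TX^n \otimes {\mathcal O}_{X^n}\bigl(\textstyle\sum_{1 \le j < k \le n} m_{j,k}\,\Delta_{j,k}\bigr)\Bigr) = 0,$$ that is, the only holomorphic section over $X^n$ of the holomorphic vector bundle $TX^n \otimes {\mathcal O}_{X^n}(\sum_{j<k} m_{j,k}\,\Delta_{j,k})$ is the zero section. -/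

import Mathlib

open scoped Manifold ContDiff Topology Bundle

noncomputable section

/-! ### Tensor products of bundles given by cocycles -/

section Tensor

variable {B : Type*} [TopologicalSpace B] {F : Type*} [NormedAddCommGroup F] [NormedSpace ℂ F]
  {ι κ P : Type*}

/-- The tensor product `E ⊗ L` of a vector bundle `E` (given by a cocycle with model fibre `F`) with
a line bundle `L` (given by a cocycle with model fibre `ℂ`).  Under `F ⊗ ℂ = F` the transition
functions of `E ⊗ L` are those of `E` multiplied by the scalar transition functions of `L`. -/
def tensorLine (E : VectorBundleCore ℂ B F ι) (L : VectorBundleCore ℂ B ℂ κ) :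
    VectorBundleCore ℂ B F (ι × κ) where
  baseSet i := E.baseSet i.1 ∩ L.baseSet i.2
  isOpen_baseSet i := (E.isOpen_baseSet i.1).inter (L.isOpen_baseSet i.2)
  indexAt x := (E.indexAt x, L.indexAt x)
  mem_baseSet_at x := ⟨E.mem_baseSet_at x, L.mem_baseSet_at x⟩
  coordChange i j x := L.coordChange i.2 j.2 x 1 • E.coordChange i.1 j.1 x
  coordChange_self i x hx v := by
    simp [E.coordChange_self i.1 x hx.1, L.coordChange_self i.2 x hx.2]
  continuousOn_coordChange i j := by
    refine ContinuousOn.smul (f := fun x => L.coordChange i.2 j.2 x 1) ?_ ?_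
    · exact ((L.continuousOn_coordChange i.2 j.2).mono
        (fun x hx => ⟨hx.1.2, hx.2.2⟩)).clm_apply continuousOn_const
    · exact (E.continuousOn_coordChange i.1 j.1).mono (fun x hx => ⟨hx.1.1, hx.2.1⟩)
  coordChange_comp i j k x hx v := by
    have h1 := E.coordChange_comp i.1 j.1 k.1 x ⟨⟨hx.1.1.1, hx.1.2.1⟩, hx.2.1⟩ v
    have h2 := L.coordChange_comp i.2 j.2 k.2 x ⟨⟨hx.1.1.2, hx.1.2.2⟩, hx.2.2⟩ 1
    have h3 : L.coordChange j.2 k.2 x (L.coordChange i.2 j.2 x 1)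
        = L.coordChange i.2 j.2 x 1 * L.coordChange j.2 k.2 x 1 := by
      conv_lhs => rw [← mul_one (L.coordChange i.2 j.2 x 1), ← smul_eq_mul, map_smul, smul_eq_mul]
    rw [h3] at h2
    simp only [_root_.smul_apply, map_smul, h1, smul_smul, h2]

/-- The line bundle `⨂ₚ Lₚ^{⊗ mₚ}` of a finite family of line bundles `Lₚ`: its transition functions
are the products of the `mₚ`-th powers of the transition functions of the `Lₚ`. -/
def tensorPowers [Fintype P] (L : P → VectorBundleCore ℂ B ℂ κ) (m : P → ℕ) :
    VectorBundleCore ℂ B ℂ (P → κ) where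
  baseSet i := ⋂ p, (L p).baseSet (i p)
  isOpen_baseSet i := isOpen_iInter_of_finite fun p => (L p).isOpen_baseSet (i p)
  indexAt x p := (L p).indexAt x
  mem_baseSet_at x := Set.mem_iInter.2 fun p => (L p).mem_baseSet_at x
  coordChange i j x :=
    (∏ p, (L p).coordChange (i p) (j p) x 1 ^ m p) • ContinuousLinearMap.id ℂ ℂ
  coordChange_self i x hx v := by
    have : ∀ p, (L p).coordChange (i p) (i p) x 1 = 1 := fun p =>
      (L p).coordChange_self (i p) x (Set.mem_iInter.1 hx p) 1
    simp [this]
  continuousOn_coordChange i j := by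
    refine ContinuousOn.smul (f := fun x => ∏ p, (L p).coordChange (i p) (j p) x 1 ^ m p)
      (continuousOn_finsetProd _ fun p _ => ContinuousOn.pow ?_ _) continuousOn_const
    exact (((L p).continuousOn_coordChange (i p) (j p)).mono
      (fun x hx => ⟨Set.mem_iInter.1 hx.1 p, Set.mem_iInter.1 hx.2 p⟩)).clm_apply continuousOn_const
  coordChange_comp i j k x hx v := by
    have h : ∀ p, (L p).coordChange (j p) (k p) x 1 * (L p).coordChange (i p) (j p) x 1
        = (L p).coordChange (i p) (k p) x 1 := fun p => by
      have h2 := (L p).coordChange_comp (i p) (j p) (k p) x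
        ⟨⟨Set.mem_iInter.1 hx.1.1 p, Set.mem_iInter.1 hx.1.2 p⟩, Set.mem_iInter.1 hx.2 p⟩ 1
      rw [← h2]
      conv_rhs => rw [← mul_one ((L p).coordChange (i p) (j p) x 1), ← smul_eq_mul, map_smul,
        smul_eq_mul, mul_comm]
    simp only [_root_.smul_apply, ContinuousLinearMap.id_apply, smul_eq_mul,
      ← mul_assoc, ← Finset.prod_mul_distrib, ← mul_pow, h]

end Tensor

/-! ### Riemann surfaces, their genus and their self-products -/

section Surface

variable (X : Type*) [TopologicalSpace X] [ChartedSpace ℂ X]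

/-- The space `H⁰(X, K_X)` of holomorphic `1`-forms on a Riemann surface `X`. -/
abbrev HolomorphicOneForm [IsManifold 𝓘(ℂ) ω X] : Type _ :=
  Cₛ^ω⟮𝓘(ℂ); ℂ →L[ℂ] ℂ, fun x : X => TangentSpace 𝓘(ℂ) x →L[ℂ] Bundle.Trivial X ℂ x⟯

/-- The genus of a compact Riemann surface: the dimension of its space of holomorphic `1`-forms. -/
def genus [IsManifold 𝓘(ℂ) ω X] : ℕ := Module.finrank ℂ (HolomorphicOneForm X)

/-- The model `ℂⁿ` of the complex manifold `Xⁿ`. -/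
abbrev productModel (n : ℕ) : ModelWithCorners ℂ (Fin n → ℂ) (ModelPi fun _ : Fin n => ℂ) :=
  ModelWithCorners.pi fun _ : Fin n => 𝓘(ℂ)

variable {X}

theorem analyticAt_chartChange [IsManifold 𝓘(ℂ) ω X] (a b : atlas ℂ X) {p : X}
    (ha : p ∈ a.1.source) (hb : p ∈ b.1.source) : AnalyticAt ℂ (b.1 ∘ a.1.symm) (a.1 p) := by
  have h : ContDiffOn ℂ ω (b.1 ∘ a.1.symm) (a.1.symm ≫ₕ b.1).source := by
    simpa [contDiffGroupoid, mem_groupoid_of_pregroupoid, contDiffPregroupoid] using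
      (mem_groupoid_of_pregroupoid.1 ((contDiffGroupoid ω 𝓘(ℂ)).compatible a.2 b.2)).1
  have hm : a.1 p ∈ (a.1.symm ≫ₕ b.1).source := by
    simp [a.1.map_source ha, a.1.left_inv ha, hb]
  exact (h.contDiffAt ((a.1.symm ≫ₕ b.1).open_source.mem_nhds hm)).analyticAt

/-- The product `Xⁿ` of a Riemann surface is a complex manifold. -/
instance isManifold_selfProduct [IsManifold 𝓘(ℂ) ω X] (n : ℕ) :
    IsManifold (productModel n) ω (Fin n → X) := by
  apply isManifold_of_contDiffOn
  rintro _ _ ⟨a, ha, rfl⟩ ⟨b, hb, rfl⟩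
  rw [contDiffOn_pi]
  rintro i z ⟨hz, -⟩
  have hz' : z i ∈ (a i).target ∧ (a i).symm (z i) ∈ (b i).source := by
    have h1 := hz.1 i trivial
    have h2 := hz.2 i trivial
    exact ⟨h1, h2⟩
  have h := analyticAt_chartChange (X := X) ⟨a i, ha i trivial⟩ ⟨b i, hb i trivial⟩
    ((a i).map_target hz'.1) hz'.2
  rw [(a i).right_inv hz'.1] at h
  exact (h.contDiffAt.comp z (contDiff_apply ℂ ℂ i).contDiffAt).contDiffWithinAt

/-! ### The line bundle of a diagonal -/

variable {n : ℕ}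

/-- The open cover of `Xⁿ` on which local equations of `Δ_{j,k} = {x | x j = x k}` are given: the
complement of `Δ_{j,k}` (index `none`), and, for each chart `a` of `X`, the set of points whose
`j`-th and `k`-th coordinates both lie in the domain of `a` (index `some a`). -/
def diagonalCover (j k : Fin n) : Option (atlas ℂ X) → Set (Fin n → X)
  | none => {x | x j ≠ x k}
  | some a => {x | x j ∈ a.1.source ∧ x k ∈ a.1.source}

/-- The local equations of the divisor `Δ_{j,k}` on the sets of the cover: `1` on the complement of
`Δ_{j,k}` and `a (x j) - a (x k)` for a chart `a`. -/
def diagonalEquation (j k : Fin n) : Option (atlas ℂ X) → (Fin n → X) → ℂ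
  | none, _ => 1
  | some a, x => a.1 (x j) - a.1 (x k)

/-- The derivative at `p` of the change of charts `b ∘ a⁻¹` (the value `1` when an index is `none`
is never used on the cover). -/
def chartChangeDeriv : Option (atlas ℂ X) → Option (atlas ℂ X) → X → ℂ
  | some a, some b, p => deriv (b.1 ∘ a.1.symm) (a.1 p)
  | _, _, _ => 1

open Classical in
/-- The transition functions of the line bundle `O(Δ_{j,k})`: the quotients `f_b / f_a` of the local
equations of `Δ_{j,k}`, whose holomorphic extension across `Δ_{j,k}` is the derivative of the change
of charts. -/
def diagonalTransition (j k : Fin n) (a b : Option (atlas ℂ X)) (x : Fin n → X) : ℂ :=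
  if x j = x k then chartChangeDeriv a b (x j)
  else diagonalEquation j k b x / diagonalEquation j k a x

theorem diagonalEquation_ne_zero (j k : Fin n) (a : Option (atlas ℂ X)) {x : Fin n → X}
    (hx : x ∈ diagonalCover j k a) (h : x j ≠ x k) : diagonalEquation j k a x ≠ 0 := by
  cases a with
  | none => exact one_ne_zero
  | some a => exact sub_ne_zero.2 fun e => h (a.1.injOn hx.1 hx.2 e)

theorem isOpen_diagonalCover [T2Space X] (j k : Fin n) (a : Option (atlas ℂ X)) :
    IsOpen (diagonalCover j k a) := by
  cases a with
  | none => exact isOpen_ne_fun (continuous_apply j) (continuous_apply k)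
  | some a =>
    have hj : Continuous fun x : Fin n → X => x j := continuous_apply j
    have hk : Continuous fun x : Fin n → X => x k := continuous_apply k
    exact (a.1.open_source.preimage hj).inter (a.1.open_source.preimage hk)

theorem continuousOn_diagonalEquation (j k : Fin n) (a : Option (atlas ℂ X)) :
    ContinuousOn (diagonalEquation j k a) (diagonalCover j k a) := by
  cases a with
  | none => exact continuousOn_const
  | some a =>
    exact (a.1.continuousOn.comp (continuous_apply j).continuousOn fun x hx => hx.1).sub
      (a.1.continuousOn.comp (continuous_apply k).continuousOn fun x hx => hx.2)

/-- The local equations of `Δ_{j,k}` are the components of a section of `O(Δ_{j,k})`. -/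
theorem diagonalTransition_mul_equation (j k : Fin n) (a b : Option (atlas ℂ X)) {x : Fin n → X}
    (ha : x ∈ diagonalCover j k a) (hb : x ∈ diagonalCover j k b) :
    diagonalTransition j k a b x * diagonalEquation j k a x = diagonalEquation j k b x := by
  unfold diagonalTransition
  split_ifs with h
  · cases a with
    | none => exact absurd h ha
    | some a =>
      cases b with
      | none => exact absurd h hb
      | some b => simp [diagonalEquation, h]
  · exact div_mul_cancel₀ _ (diagonalEquation_ne_zero j k a ha h)

theorem continuousOn_diagonalTransition [T2Space X] [IsManifold 𝓘(ℂ) ω X] (j k : Fin n)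
    (a b : Option (atlas ℂ X)) :
    ContinuousOn (diagonalTransition j k a b) (diagonalCover j k a ∩ diagonalCover j k b) := by
  intro x hx
  by_cases h : x j = x k
  · cases a with
    | none => exact absurd h hx.1
    | some a =>
    cases b with
    | none => exact absurd h hx.2
    | some b =>
    set f : ℂ → ℂ := b.1 ∘ a.1.symm with hf
    have hA : AnalyticAt ℂ f (a.1 (x j)) := analyticAt_chartChange a b hx.1.1 hx.2.1
    have hxval : diagonalTransition j k (some a) (some b) x = deriv f (a.1 (x j)) := by
      simp [diagonalTransition, h, chartChangeDeriv, hf]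
    have hj : ContinuousAt (fun y : Fin n → X => a.1 (y j)) x :=
      (a.1.continuousAt hx.1.1).comp (f := fun y : Fin n → X => y j) (continuous_apply j).continuousAt
    have hk : ContinuousAt (fun y : Fin n → X => a.1 (y k)) x :=
      (a.1.continuousAt hx.1.2).comp (f := fun y : Fin n → X => y k) (continuous_apply k).continuousAt
    have hd : ContinuousAt (fun y : Fin n → X => deriv f (a.1 (y j))) x :=
      hA.deriv.continuousAt.comp (f := fun y : Fin n → X => a.1 (y j)) hj
    have hs := hA.hasStrictDerivAt.isLittleO
    refine ContinuousAt.continuousWithinAt ?_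
    rw [Metric.continuousAt_iff']
    intro ε hε
    have hpair : Filter.Tendsto (fun y : Fin n → X => (a.1 (y j), a.1 (y k))) (𝓝 x)
        (𝓝 (a.1 (x j), a.1 (x j))) := by
      have h2 := hj.tendsto.prodMk_nhds hk.tendsto
      simp only [← h] at h2
      exact h2
    have hev := hpair.eventually (hs.def (half_pos hε))
    have hU : ∀ᶠ y in 𝓝 x, y ∈ diagonalCover j k (some a) ∩ diagonalCover j k (some b) :=
      ((isOpen_diagonalCover j k (some a)).inter (isOpen_diagonalCover j k (some b))).mem_nhds hx
    filter_upwards [hev, hU, Metric.continuousAt_iff'.1 hd ε hε] with y hy hyU hyd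
    rw [hxval]
    by_cases hyjk : y j = y k
    · simpa [diagonalTransition, hyjk, chartChangeDeriv, hf] using hyd
    · have hne : a.1 (y j) - a.1 (y k) ≠ 0 := diagonalEquation_ne_zero j k (some a) hyU.1 hyjk
      have e : diagonalTransition j k (some a) (some b) y - deriv f (a.1 (x j)) =
          (f (a.1 (y j)) - f (a.1 (y k)) -
            (a.1 (y j) - a.1 (y k)) * deriv f (a.1 (x j))) / (a.1 (y j) - a.1 (y k)) := by
        simp only [diagonalTransition, hyjk, if_false, diagonalEquation, hf, Function.comp_apply,
          a.1.left_inv hyU.1.1, a.1.left_inv hyU.1.2]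
        field_simp
      rw [dist_eq_norm, e, norm_div, div_lt_iff₀ (norm_pos_iff.2 hne)]
      have hpos := norm_pos_iff.2 hne
      have hy' : ‖f (a.1 (y j)) - f (a.1 (y k)) -
            (a.1 (y j) - a.1 (y k)) * deriv f (a.1 (x j))‖ ≤ ε / 2 * ‖a.1 (y j) - a.1 (y k)‖ := by
        simpa [mul_comm] using hy
      nlinarith
  · have hN : {y : Fin n → X | y j ≠ y k} ∈ 𝓝 x :=
      (isOpen_ne_fun (continuous_apply j) (continuous_apply k)).mem_nhds h
    have hq : ContinuousWithinAt
        (fun y => diagonalEquation j k b y / diagonalEquation j k a y)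
        (diagonalCover j k a ∩ diagonalCover j k b) x :=
      ((continuousOn_diagonalEquation j k b x hx.2).mono Set.inter_subset_right).div
        ((continuousOn_diagonalEquation j k a x hx.1).mono Set.inter_subset_left)
        (diagonalEquation_ne_zero j k a hx.1 h)
    refine hq.congr_of_eventuallyEq ?_ (by simp [diagonalTransition, h])
    filter_upwards [mem_nhdsWithin_of_mem_nhds hN] with y hy
    have hy' : ¬ y j = y k := hy
    simp [diagonalTransition, hy']

theorem diagonalTransition_comp [IsManifold 𝓘(ℂ) ω X] (j k : Fin n)
    (a b c : Option (atlas ℂ X)) {x : Fin n → X} (ha : x ∈ diagonalCover j k a)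
    (hb : x ∈ diagonalCover j k b) (hc : x ∈ diagonalCover j k c) :
    diagonalTransition j k b c x * diagonalTransition j k a b x = diagonalTransition j k a c x := by
  unfold diagonalTransition
  split_ifs with h
  · cases a with
    | none => exact absurd h ha
    | some a =>
    cases b with
    | none => exact absurd h hb
    | some b =>
    cases c with
    | none => exact absurd h hc
    | some c =>
    have h1 := (analyticAt_chartChange a b ha.1 hb.1).differentiableAt
    have h2 := (analyticAt_chartChange b c hb.1 hc.1).differentiableAt
    have e : (b.1 ∘ a.1.symm) (a.1 (x j)) = b.1 (x j) := by simp [a.1.left_inv ha.1]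
    have h3 := deriv_comp (h₂ := c.1 ∘ b.1.symm) (h := b.1 ∘ a.1.symm) (a.1 (x j)) (e ▸ h2) h1
    rw [e] at h3
    simp only [chartChangeDeriv]
    rw [← h3]
    refine Filter.EventuallyEq.deriv_eq ?_
    have hm : a.1 (x j) ∈ (a.1.symm ≫ₕ b.1).source := by
      simp [a.1.map_source ha.1, a.1.left_inv ha.1, hb.1]
    filter_upwards [(a.1.symm ≫ₕ b.1).open_source.mem_nhds hm] with z hz
    simp only [OpenPartialHomeomorph.trans_source, Set.mem_inter_iff, Set.mem_preimage] at hz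
    simp [b.1.left_inv hz.2]
  · have := diagonalEquation_ne_zero j k a ha h
    have := diagonalEquation_ne_zero j k b hb h
    field_simp

variable (X) in
open Classical in
/-- The line bundle `O(Δ_{j,k})` on `Xⁿ`. -/
def diagonalLineBundle [T2Space X] [IsManifold 𝓘(ℂ) ω X] (j k : Fin n) :
    VectorBundleCore ℂ (Fin n → X) ℂ (Option (atlas ℂ X)) where
  baseSet := diagonalCover j k
  isOpen_baseSet := isOpen_diagonalCover j k
  indexAt x := if x j = x k then some (achart ℂ (x j)) else none
  mem_baseSet_at x := by
    split_ifs with h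
    · exact ⟨mem_chart_source ℂ (x j), h ▸ mem_chart_source ℂ (x j)⟩
    · exact h
  coordChange a b x := diagonalTransition j k a b x • ContinuousLinearMap.id ℂ ℂ
  coordChange_self a x hx v := by
    have h1 : diagonalTransition j k a a x = 1 := by
      unfold diagonalTransition
      split_ifs with h
      · cases a with
        | none => rfl
        | some a =>
          have : a.1 ∘ a.1.symm =ᶠ[𝓝 (a.1 (x j))] id := by
            filter_upwards [a.1.open_target.mem_nhds (a.1.map_source hx.1)] with z hz
            simp [a.1.right_inv hz]
          simp [chartChangeDeriv, this.deriv_eq]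
      · exact div_self (diagonalEquation_ne_zero j k a hx h)
    simp [h1]
  continuousOn_coordChange a b :=
    (continuousOn_diagonalTransition j k a b).smul continuousOn_const
  coordChange_comp a b c x hx v := by
    simp [← diagonalTransition_comp j k a b c hx.1.1 hx.1.2 hx.2, mul_assoc]

/-- The pairs `(j, k)` with `j < k`, which index the diagonals of `Xⁿ`. -/
abbrev DiagonalPair (n : ℕ) : Type := {p : Fin n × Fin n // p.1 < p.2}

variable (X) in
/-- The line bundle `O(∑_{j < k} m_{j,k} Δ_{j,k})` on `Xⁿ`. -/
def diagonalDivisorBundle [T2Space X] [IsManifold 𝓘(ℂ) ω X] (m : DiagonalPair n → ℕ) :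
    VectorBundleCore ℂ (Fin n → X) ℂ (DiagonalPair n → Option (atlas ℂ X)) :=
  tensorPowers (fun p : DiagonalPair n => diagonalLineBundle X p.1.1 p.1.2) m

variable (X) in
/-- The vector bundle `TXⁿ ⊗ O(∑_{j < k} m_{j,k} Δ_{j,k})` on `Xⁿ`. -/
def twistedTangentBundle [T2Space X] [IsManifold 𝓘(ℂ) ω X] (m : DiagonalPair n → ℕ) :
    VectorBundleCore ℂ (Fin n → X) (Fin n → ℂ) (atlas (ModelPi fun _ : Fin n => ℂ) (Fin n → X) ×
      (DiagonalPair n → Option (atlas ℂ X))) :=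
  tensorLine (tangentBundleCore (productModel n) (Fin n → X)) (diagonalDivisorBundle X m)

end Surface

end

/-
With the convention `O(Δ_{j,j}) = TX_j`, the pullback of `TX` by the `j`-th projection, the `i`-th
component of a section of `TXⁿ ⊗ O(D)` is a section of `O(Δ_{i,i} + D)`. The restriction of `O(Δ)`
to the diagonal `Δ ⊆ X²` is the tangent line of `X`, so the bundles `O(D)`, for all multisets `D` of
pairs `(j, k)`, are stable under restriction to diagonals. By induction on `n` and `D`, every
section of `O(D)` is a multiple of the canonical one, hence zero if `D` contains some `(j, j)`:

* for `D = 0` this is the maximum principle;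
* a section of `O(D + Δ_{j,k})` with `j ≠ k` restricts on `Δ_{j,k} ≅ Xⁿ⁻¹` to a section of a bundle
  with a tangent factor, so it vanishes there and comes from a section of `O(D)`;
* a section of `O(D + Δ_{j,j})`, contracted with a nonzero form `η` that has a zero `q`, is a
  multiple of the canonical section of `O(D)` which vanishes where `x j = q`, so it is zero. Such a
  form exists because the genus is at least `2`.
-/

noncomputable section

section Division

variable {𝕜 E F : Type*} [NontriviallyNormedField 𝕜] [NormedAddCommGroup E] [NormedSpace 𝕜 E]
  [NormedAddCommGroup F] [NormedSpace 𝕜 F]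

/-- The power series of the quotient of `∑ pₙ` by a linear form `ℓ` on whose kernel `∑ pₙ` vanishes.
Here `e` is a vector with `ℓ e = 1` and `B` is the projection onto the kernel along `e`: the `m`-th
term is `(pₘ₊₁ (y, …, y) - pₘ₊₁ (B y, …, B y)) / ℓ y`, expanded as a telescoping sum. -/
def quotientSeries (p : FormalMultilinearSeries 𝕜 E F) (B : E →L[𝕜] E) (e : E) :
    FormalMultilinearSeries 𝕜 E F := fun m =>
  ∑ i : Fin (m + 1), ((p (m + 1)).compContinuousLinearMap
    (fun l => if l ≤ i then ContinuousLinearMap.id 𝕜 E else B)).curryMid i e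

theorem smul_quotientSeries_apply (p : FormalMultilinearSeries 𝕜 E F) {B : E →L[𝕜] E} {e : E}
    {ℓ : E →L[𝕜] 𝕜} (hB : ∀ z, z - B z = ℓ z • e) (m : ℕ) (y : E) :
    ℓ y • quotientSeries p B e m (fun _ => y) =
      p (m + 1) (fun _ => y) - p (m + 1) (fun _ => B y) := by
  have telescope := (p (m + 1)).toMultilinearMap.map_piecewise_sub_map_piecewise
    (fun _ => y) (fun _ => B y) 0 Finset.univ
  simp only [Finset.piecewise_univ, Finset.mem_univ, if_true, hB,
    ContinuousMultilinearMap.coe_coe] at telescope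
  rw [telescope, quotientSeries, _root_.sum_apply, Finset.smul_sum]
  refine Finset.sum_congr rfl fun i _ => ?_
  have hupdate : (fun l => if l < i then y else if l = i then ℓ y • e else B y) =
      Function.update (fun l => if l < i then y else B y) i (ℓ y • e) := by
    funext l
    obtain rfl | hl := eq_or_ne l i <;> simp [*]
  rw [hupdate, (p (m + 1)).map_update_smul, ContinuousMultilinearMap.curryMid_apply,
    ContinuousMultilinearMap.compContinuousLinearMap_apply]
  congr 2
  funext l
  cases l using i.succAboveCases with
  | x => simp
  | p l =>
    have hle : i.succAbove l ≤ i ↔ i.succAbove l < i := (i.succAbove_ne l).le_iff_lt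
    by_cases hlt : i.succAbove l < i <;> simp [hle, hlt]

theorem norm_quotientSeries_le (p : FormalMultilinearSeries 𝕜 E F) (B : E →L[𝕜] E) (e : E) (m : ℕ) :
    ‖quotientSeries p B e m‖ ≤ (m + 1) * (‖p (m + 1)‖ * (max 1 ‖B‖) ^ (m + 1) * ‖e‖) := by
  refine (norm_sum_le_of_le _ fun i _ => ?_).trans_eq
    (b := ∑ _i : Fin (m + 1), ‖p (m + 1)‖ * (max 1 ‖B‖) ^ (m + 1) * ‖e‖) (by simp)
  refine (ContinuousLinearMap.le_opNorm _ _).trans ?_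
  gcongr
  rw [ContinuousMultilinearMap.norm_curryMid]
  refine (ContinuousMultilinearMap.norm_compContinuousLinearMap_le _ _).trans ?_
  gcongr
  refine (Finset.prod_le_prod (g := fun _ => max 1 ‖B‖) (fun _ _ => norm_nonneg _)
    fun l _ => ?_).trans_eq (by simp)
  split_ifs
  · exact ContinuousLinearMap.norm_id_le.trans (le_max_left _ _)
  · exact le_max_right _ _

theorem quotientSeries_radius_pos {p : FormalMultilinearSeries 𝕜 E F} (hp : 0 < p.radius)
    (B : E →L[𝕜] E) (e : E) : 0 < (quotientSeries p B e).radius := by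
  obtain ⟨r, hr0, hr⟩ := ENNReal.lt_iff_exists_nnreal_btwn.1 hp
  obtain ⟨M, _, hMp⟩ := p.norm_mul_pow_le_of_lt_radius hr
  have hr0 : 0 < r := by exact_mod_cast hr0
  set C : NNReal := max 1 ‖B‖₊ with hC
  have hC0 : 0 < C := by positivity
  refine lt_of_lt_of_le (b := ((r / (2 * C) : NNReal) : ENNReal)) (by positivity)
    ((quotientSeries p B e).le_radius_of_bound (M * (C * ‖e‖ / r)) fun m => ?_)
  have hle := norm_quotientSeries_le p B e m
  have htwo : ((m : ℝ) + 1) ≤ 2 ^ m := by exact_mod_cast Nat.lt_two_pow_self (n := m)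
  push_cast
  calc ‖quotientSeries p B e m‖ * (r / (2 * C) : ℝ) ^ m
      ≤ ((m + 1) * (‖p (m + 1)‖ * C ^ (m + 1) * ‖e‖)) * (r / (2 * C) : ℝ) ^ m := by
        gcongr; simpa [hC] using hle
    _ ≤ (2 ^ m * (‖p (m + 1)‖ * C ^ (m + 1) * ‖e‖)) * (r / (2 * C) : ℝ) ^ m := by gcongr
    _ = (‖p (m + 1)‖ * r ^ (m + 1)) * (C * ‖e‖ / r) := by
        rw [div_pow, mul_pow]; field_simp; ring
    _ ≤ M * (C * ‖e‖ / r) := by gcongr; exact hMp (m + 1)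

theorem hasSum_smul_quotientSeries {p : FormalMultilinearSeries 𝕜 E F} {B : E →L[𝕜] E} {e : E}
    {ℓ : E →L[𝕜] 𝕜} (hB : ∀ z, z - B z = ℓ z • e) {y : E} {a b : F}
    (ha : HasSum (fun n => p n fun _ => y) a) (hb : HasSum (fun n => p n fun _ => B y) b) :
    HasSum (fun m => ℓ y • quotientSeries p B e m fun _ => y) (a - b) := by
  have hzero : (p 0 fun _ => y) = p 0 fun _ => B y := congrArg _ (Subsingleton.elim _ _)
  have h := (hasSum_nat_add_iff' 1).2 (ha.sub hb)
  simpa only [smul_quotientSeries_apply p hB, Finset.sum_range_one, hzero, sub_self, sub_zero]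
    using h

theorem exists_analyticAt_eq_smul [CompleteSpace F] {f : E → F} {z₀ e : E} {ℓ : E →L[𝕜] 𝕜}
    (hf : AnalyticAt 𝕜 f z₀) (he : ℓ e = 1) (hz₀ : ℓ z₀ = 0)
    (hzero : ∀ᶠ z in 𝓝 z₀, ℓ z = 0 → f z = 0) :
    ∃ q : E → F, AnalyticAt 𝕜 q z₀ ∧ ∀ᶠ z in 𝓝 z₀, f z = ℓ z • q z := by
  obtain ⟨p, hp⟩ := hf
  let B : E →L[𝕜] E := ContinuousLinearMap.id 𝕜 E - ℓ.smulRight e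
  have hB : ∀ z, z - B z = ℓ z • e := fun z => by simp [B]
  have hq := (quotientSeries p B e).hasFPowerSeriesOnBall
    (quotientSeries_radius_pos hp.radius_pos B e)
  have hsub : Filter.Tendsto (fun z => z - z₀) (𝓝 z₀) (𝓝 0) :=
    tendsto_sub_nhds_zero_iff.2 Filter.tendsto_id
  have hproj : Filter.Tendsto (fun z => z₀ + B (z - z₀)) (𝓝 z₀) (𝓝 z₀) := by
    simpa using ((B.continuous.tendsto 0).comp hsub).const_add z₀
  refine ⟨fun z => (quotientSeries p B e).sum (z - z₀),
    AnalyticAt.comp_of_eq (f := fun z => z - z₀) hq.analyticAt (by fun_prop) (sub_self z₀), ?_⟩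
  filter_upwards [hp.eventually_hasSum_sub, hproj.eventually hp.eventually_hasSum_sub,
    hproj.eventually hzero, hsub.eventually hq.hasFPowerSeriesAt.eventually_hasSum]
    with z hfz hfproj hzeroz hqz
  have hfproj_zero : f (z₀ + B (z - z₀)) = 0 := hzeroz (by simp [B, he, hz₀])
  simp only [hfproj_zero, add_sub_cancel_left] at hfproj
  have hdiff := hasSum_smul_quotientSeries hB hfz hfproj
  rw [sub_zero] at hdiff
  simpa [hz₀] using hdiff.unique (hqz.const_smul (ℓ (z - z₀)))

end Division

section Product

variable {X : Type*} [TopologicalSpace X] [ChartedSpace ℂ X] {n : ℕ}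

theorem contMDiffAt_productModel {E H M : Type*} [NormedAddCommGroup E] [NormedSpace ℂ E]
    [TopologicalSpace H] {I : ModelWithCorners ℂ E H} [TopologicalSpace M] [ChartedSpace H M]
    {f : M → Fin n → X} {p : M} :
    ContMDiffAt I (productModel n) ω f p ↔ ∀ i, ContMDiffAt I 𝓘(ℂ) ω (fun y => f y i) p := by
  rw [contMDiffAt_iff_target, continuousAt_pi, contMDiffAt_pi_space, ← forall_and]
  exact forall_congr' fun i => (contMDiffAt_iff_target (I' := 𝓘(ℂ)) (f := fun y => f y i)).symm

theorem contMDiff_apply_productModel (i : Fin n) :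
    ContMDiff (productModel n) 𝓘(ℂ) ω fun x : Fin n → X => x i :=
  fun _ => contMDiffAt_productModel.1 contMDiffAt_id i

theorem contMDiff_reindex {l : ℕ} (σ : Fin n → Fin l) :
    ContMDiff (productModel l) (productModel n) ω fun x : Fin l → X => x ∘ σ :=
  fun x => contMDiffAt_productModel.2 fun i => contMDiff_apply_productModel (σ i) x

instance boundaryless_productModel (n : ℕ) : (productModel n).Boundaryless :=
  ⟨Set.range_eq_univ.2 fun z => ⟨z, rfl⟩⟩

theorem analyticAt_comp_extChartAt_symm {F : Type*} [NormedAddCommGroup F] [NormedSpace ℂ F]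
    {f : (Fin n → X) → F} {p : Fin n → X} (hf : ContMDiffAt (productModel n) 𝓘(ℂ, F) ω f p) :
    AnalyticAt ℂ (f ∘ (extChartAt (productModel n) p).symm) (extChartAt (productModel n) p p) := by
  have h := (contMDiffAt_iff.1 hf).2
  rw [ModelWithCorners.range_eq_univ] at h
  exact (h.contDiffAt Filter.univ_mem).analyticAt

theorem exists_eq_const_of_contMDiff [CompactSpace X] [ConnectedSpace X] [IsManifold 𝓘(ℂ) ω X]
    {f : (Fin n → X) → ℂ} (hf : ContMDiff (productModel n) 𝓘(ℂ) ω f) : ∃ c, ∀ x, f x = c := by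
  have : IsManifold (productModel n) 1 (Fin n → X) := .of_le (n := ω) le_top
  obtain ⟨c, hc⟩ := (hf.mdifferentiable (by simp)).exists_eq_const_of_compactSpace
  exact ⟨c, congrFun hc⟩

theorem exists_contMDiffAt_eq_diagonalEquation_smul [T2Space X] [IsManifold 𝓘(ℂ) ω X] {F : Type*}
    [NormedAddCommGroup F] [NormedSpace ℂ F] [CompleteSpace F] {j k : Fin n} (hjk : j ≠ k)
    {f : (Fin n → X) → F} {p : Fin n → X} (hf : ContMDiffAt (productModel n) 𝓘(ℂ, F) ω f p)
    (hzero : ∀ x, x j = x k → f x = 0) :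
    ∃ g : (Fin n → X) → F, ContMDiffAt (productModel n) 𝓘(ℂ, F) ω g p ∧
      ∀ᶠ x in 𝓝 p, f x =
        diagonalEquation j k ((diagonalLineBundle X j k).indexAt p) x • g x := by
  by_cases hp : p j = p k
  · let φ := extChartAt (productModel n) p
    let ℓ : (Fin n → ℂ) →L[ℂ] ℂ := .proj j - .proj k
    have hℓ (x : Fin n → X) :
        diagonalEquation j k ((diagonalLineBundle X j k).indexAt p) x = ℓ (φ x) := by
      simp only [diagonalLineBundle, if_pos hp]
      change _ = chartAt ℂ (p j) (x j) - chartAt ℂ (p k) (x k)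
      rw [← hp]
      rfl
    have hℓe : ℓ (Pi.single j 1) = 1 := by simp [ℓ, hjk.symm]
    have hℓp : ℓ (φ p) = 0 := by simp [← hℓ, diagonalLineBundle, hp, diagonalEquation]
    have hzeroφ : ∀ z, ℓ z = 0 → (f ∘ φ.symm) z = 0 := fun z hz => hzero _ <| by
      change (chartAt ℂ (p j)).symm (z j) = (chartAt ℂ (p k)).symm (z k)
      rw [hp, show z j = z k from sub_eq_zero.1 hz]
    obtain ⟨q, hq, hfq⟩ :=
      exists_analyticAt_eq_smul (analyticAt_comp_extChartAt_symm hf) hℓe hℓp (.of_forall hzeroφ)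
    refine ⟨q ∘ φ, hq.contDiffAt.contMDiffAt.comp p contMDiffAt_extChartAt, ?_⟩
    filter_upwards [(continuousAt_extChartAt p).eventually hfq,
      extChartAt_source_mem_nhds (I := productModel n) p] with x hfqx hx
    rw [hℓ, Function.comp_apply, ← hfqx, Function.comp_apply, φ.left_inv hx]
  · exact ⟨f, hf, .of_forall fun x => by simp [diagonalLineBundle, hp, diagonalEquation]⟩

end Product

section Forms

variable {X : Type*} [TopologicalSpace X] [ChartedSpace ℂ X]

theorem eventually_eq_zero_or_ne_zero_of_contMDiffAt {f : X → ℂ} {q : X}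
    (hf : ContMDiffAt 𝓘(ℂ) 𝓘(ℂ) ω f q) :
    (∀ᶠ x in 𝓝 q, f x = 0) ∨ ∀ᶠ x in 𝓝[≠] q, f x ≠ 0 := by
  have hq := mem_chart_source ℂ q
  have hanalytic : AnalyticAt ℂ (f ∘ (chartAt ℂ q).symm) (chartAt ℂ q q) :=
    ((contMDiffAt_iff.1 hf).2.contDiffAt (by simp)).analyticAt
  have hchart := (chartAt ℂ q).continuousAt hq
  have hsource := (chartAt ℂ q).open_source.mem_nhds hq
  refine hanalytic.eventually_eq_zero_or_eventually_ne_zero.imp (fun h => ?_) fun h => ?_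
  · filter_upwards [hchart.eventually h, hsource] with x hx hxs
    rwa [Function.comp_apply, (chartAt ℂ q).left_inv hxs] at hx
  · rw [eventually_nhdsWithin_iff] at h ⊢
    filter_upwards [hchart.eventually h, hsource] with x hx hxs hxq
    rw [Function.comp_apply, (chartAt ℂ q).left_inv hxs] at hx
    exact hx fun heq => hxq ((chartAt ℂ q).injOn hxs hq heq)

theorem chartChangeDeriv_self (a : atlas ℂ X) {x : X} (hx : x ∈ a.1.source) :
    chartChangeDeriv (some a) (some a) x = 1 := by
  have h : a.1 ∘ a.1.symm =ᶠ[𝓝 (a.1 x)] id := a.1.eventually_right_inverse (a.1.map_source hx)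
  simp [chartChangeDeriv, h.deriv_eq]

variable [IsManifold 𝓘(ℂ) ω X]

theorem chartChangeDeriv_mul_chartChangeDeriv (a b : atlas ℂ X) {x : X} (ha : x ∈ a.1.source)
    (hb : x ∈ b.1.source) :
    chartChangeDeriv (some a) (some b) x * chartChangeDeriv (some b) (some a) x = 1 := by
  have h := diagonalTransition_comp (n := 1) 0 0 (some b) (some a) (some b) (x := fun _ => x)
    ⟨hb, hb⟩ ⟨ha, ha⟩ ⟨hb, hb⟩
  simpa [diagonalTransition, chartChangeDeriv_self b hb] using h

/-- The coefficient of a holomorphic one-form at each point `x`, in the preferred chart at `x`. -/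
def formCoefficient (η : HolomorphicOneForm X) (x : X) : ℂ := η x (1 : ℂ)

theorem inCoordinates_oneForm (η : HolomorphicOneForm X) {q x : X}
    (hx : x ∈ (chartAt ℂ q).source) :
    ContinuousLinearMap.inCoordinates ℂ (TangentSpace 𝓘(ℂ)) ℂ (Bundle.Trivial X ℂ) q x q x (η x) 1 =
      formCoefficient η x * chartChangeDeriv (some (achart ℂ q)) (some (achart ℂ x)) x := by
  set d := chartChangeDeriv (some (achart ℂ q)) (some (achart ℂ x)) x
  have hsymmL : (trivializationAt ℂ (TangentSpace 𝓘(ℂ)) q).symmL ℂ x (1 : ℂ) = d • (1 : ℂ) := by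
    rw [TangentBundle.symmL_trivializationAt_eq_core hx, tangentBundleCore_coordChange_achart,
      ModelWithCorners.range_eq_univ, fderivWithin_univ]
    exact (mul_one d).symm
  calc _ = η x ((trivializationAt ℂ (TangentSpace 𝓘(ℂ)) q).symmL ℂ x (1 : ℂ)) := by
        simp [ContinuousLinearMap.inCoordinates]
    _ = d * formCoefficient η x := by rw [hsymmL]; exact (η x).map_smul d (1 : ℂ)
    _ = formCoefficient η x * d := mul_comm _ _

theorem contMDiffAt_formCoefficient_mul (η : HolomorphicOneForm X) (q : X) :
    ContMDiffAt 𝓘(ℂ) 𝓘(ℂ) ω (fun x => formCoefficient η x *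
      chartChangeDeriv (some (achart ℂ q)) (some (achart ℂ x)) x) q := by
  have h := ((contMDiffAt_hom_bundle _).1 (η.contMDiff q)).2
  refine (h.clm_apply (contMDiffAt_const (c := (1 : ℂ)))).congr_of_eventuallyEq ?_
  filter_upwards [(chartAt ℂ q).open_source.mem_nhds (mem_chart_source ℂ q)] with x hx
  exact (inCoordinates_oneForm η hx).symm

theorem formCoefficient_eventually_eq_zero_or_ne_zero (η : HolomorphicOneForm X) (q : X) :
    (∀ᶠ x in 𝓝 q, formCoefficient η x = 0) ∨ ∀ᶠ x in 𝓝[≠] q, formCoefficient η x ≠ 0 := by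
  have hsource := (chartAt ℂ q).open_source.mem_nhds (mem_chart_source ℂ q)
  refine (eventually_eq_zero_or_ne_zero_of_contMDiffAt
    (contMDiffAt_formCoefficient_mul η q)).imp (fun h => ?_) fun h => ?_
  · filter_upwards [h, hsource] with x hx hxs
    exact (mul_eq_zero.1 hx).resolve_right <| right_ne_zero_of_mul_eq_one <|
      chartChangeDeriv_mul_chartChangeDeriv _ _ (mem_chart_source ℂ x) hxs
  · filter_upwards [h] with x hx using left_ne_zero_of_mul hx

theorem dense_formCoefficient_ne_zero [PreconnectedSpace X] {η : HolomorphicOneForm X}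
    (hη : η ≠ 0) : Dense {x | formCoefficient η x ≠ 0} := by
  have hclosed : IsClosed {q | ∀ᶠ x in 𝓝 q, formCoefficient η x = 0} := by
    refine isClosed_of_closure_subset fun q hq => ?_
    by_contra hqS
    rw [← Set.sdiff_singleton_eq_self hqS, mem_closure_ne_iff_frequently_within] at hq
    refine hq ?_
    filter_upwards [(formCoefficient_eventually_eq_zero_or_ne_zero η q).resolve_left hqS]
      with x hx hxS using hx hxS.self_of_nhds
  intro q
  rw [mem_closure_iff_frequently]
  intro hq
  have huniv := IsClopen.eq_univ ⟨hclosed, isOpen_setOfPred_eventually_nhds⟩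
    ⟨q, hq.mono fun x hx => not_not.1 hx⟩
  refine hη (ContMDiffSection.ext fun x => ContinuousLinearMap.ext_ring ?_)
  have hx : ∀ᶠ y in 𝓝 x, formCoefficient η y = 0 := huniv.ge (Set.mem_univ x)
  exact hx.self_of_nhds

theorem exists_oneForm_ne_zero_apply_eq_zero (hg : 2 ≤ genus X) (q : X) :
    ∃ η : HolomorphicOneForm X, η ≠ 0 ∧ formCoefficient η q = 0 := by
  let ev : HolomorphicOneForm X →ₗ[ℂ] ℂ :=
    { toFun := fun η => formCoefficient η q
      map_add' := fun _ _ => rfl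
      map_smul' := fun _ _ => rfl }
  by_contra! h
  have hinj : Function.Injective ev :=
    (injective_iff_map_eq_zero ev).2 fun η hη => by_contra fun hη0 => h η hη0 hη
  have hfinrank : genus X ≤ 1 := by
    simpa [genus] using LinearMap.finrank_le_finrank_of_injective hinj
  omega

end Forms

section Configurations

variable {X ι : Type*} [TopologicalSpace X] [ChartedSpace ℂ X]

instance neBot_nhdsWithin_ne_of_chartedSpace (x : X) : (𝓝[≠] x).NeBot := by
  have hx := mem_chart_source ℂ x
  refine ⟨fun hbot => not_isOpen_singleton (chartAt ℂ x x) ?_⟩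
  rw [← Set.image_singleton]
  exact (chartAt ℂ x).isOpen_image_of_subset_source
    ((isOpen_singleton_iff_punctured_nhds x).2 hbot) (Set.singleton_subset_iff.2 hx)

theorem dense_setOf_apply_ne_apply {j k : ι} (hjk : j ≠ k) : Dense {x : ι → X | x j ≠ x k} := by
  classical
  intro x
  have hcont : Continuous (Function.update x j) := continuous_const.update j continuous_id
  have hmem : x j ∈ closure {t : X | t ≠ x k} := dense_compl_singleton (x k) (x j)
  simpa using map_mem_closure hcont hmem (t := {x : ι → X | x j ≠ x k}) fun t ht => by
    simpa [Function.update_of_ne hjk.symm] using ht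

theorem infinite_of_chartedSpace [T1Space X] [Nonempty X] : Infinite X :=
  Set.infinite_univ_iff.1 (infinite_of_mem_nhds (Classical.arbitrary X) Filter.univ_mem)

theorem exists_injective_apply_eq {Y : Type*} [Infinite Y] [Finite ι] (i : ι) (q : Y) :
    ∃ x : ι → Y, Function.Injective x ∧ x i = q := by
  classical
  obtain ⟨f⟩ : Nonempty (ι ↪ Y) := ⟨(Finite.equivFin ι).toEmbedding.trans
    (Fin.valEmbedding.trans (Infinite.natEmbedding Y))⟩
  exact ⟨Equiv.swap (f i) q ∘ f, (Equiv.injective _).comp f.injective, by simp⟩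

end Configurations

section LocalRepresentatives

variable {B : Type*} [TopologicalSpace B] {F : Type*} [NormedAddCommGroup F] [NormedSpace ℂ F]
  {κ : Type*}

/-- The local representative, in the trivialization preferred at `p`, of a section `u` of the bundle
with cocycle `Z`. The value `u x` is given in the trivialization preferred at `x`. -/
def localRep (Z : VectorBundleCore ℂ B F κ) (u : B → F) (p x : B) : F :=
  Z.coordChange (Z.indexAt x) (Z.indexAt p) x (u x)

theorem localRep_self (Z : VectorBundleCore ℂ B F κ) (u : B → F) (p : B) :
    localRep Z u p p = u p :=
  Z.coordChange_self _ p (Z.mem_baseSet_at p) _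

theorem coordChange_localRep (Z : VectorBundleCore ℂ B F κ) (u : B → F) {p q x : B}
    (hp : x ∈ Z.baseSet (Z.indexAt p)) (hq : x ∈ Z.baseSet (Z.indexAt q)) :
    Z.coordChange (Z.indexAt p) (Z.indexAt q) x (localRep Z u p x) = localRep Z u q x :=
  Z.coordChange_comp _ _ _ x ⟨⟨Z.mem_baseSet_at x, hp⟩, hq⟩ _

theorem eventually_mem_baseSet (Z : VectorBundleCore ℂ B F κ) (p : B) :
    ∀ᶠ x in 𝓝 p, x ∈ Z.baseSet (Z.indexAt p) :=
  (Z.isOpen_baseSet _).mem_nhds (Z.mem_baseSet_at p)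

end LocalRepresentatives

section HolomorphicSections

variable {X : Type*} [TopologicalSpace X] [ChartedSpace ℂ X] {n : ℕ}
  {F : Type*} [NormedAddCommGroup F] [NormedSpace ℂ F] {κ : Type*}

/-- Holomorphic sections over `Xⁿ` of the vector bundle with cocycle `Z`, written as functions with
values in the model fibre, see `localRep`. -/
def IsHolomorphicSection (Z : VectorBundleCore ℂ (Fin n → X) F κ) (u : (Fin n → X) → F) : Prop :=
  ∀ p, ContMDiffAt (productModel n) 𝓘(ℂ, F) ω (localRep Z u p) p

variable {Z : VectorBundleCore ℂ (Fin n → X) F κ} {u v : (Fin n → X) → F}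

theorem isHolomorphicSection_coe (s : Cₛ^ω⟮productModel n; F, Z.Fiber⟯) :
    IsHolomorphicSection Z fun x => s x :=
  fun p => (Bundle.contMDiffAt_section p).1 (s.contMDiff p)

theorem IsHolomorphicSection.eq_zero_of_dense (hu : IsHolomorphicSection Z u)
    {S : Set (Fin n → X)} (hS : Dense S) (hzero : ∀ x ∈ S, u x = 0) (p : Fin n → X) :
    u p = 0 := by
  have : (𝓝[S] p).NeBot := mem_closure_iff_nhdsWithin_neBot.1 (hS p)
  rw [← localRep_self Z u p]
  refine tendsto_nhds_unique_of_eventuallyEq (l := 𝓝[S] p) (g := fun _ => 0)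
    ((hu p).continuousAt.mono_left nhdsWithin_le_nhds) tendsto_const_nhds ?_
  filter_upwards [self_mem_nhdsWithin] with x hx
  rw [localRep, hzero x hx, map_zero]

variable [IsManifold 𝓘(ℂ) ω X]

theorem IsHolomorphicSection.eq_zero_of_forall_formCoefficient_smul [PreconnectedSpace X]
    {j : Fin n} (hu : IsHolomorphicSection Z u) {η : HolomorphicOneForm X} (hη : η ≠ 0)
    (hzero : ∀ x, formCoefficient η (x j) • u x = 0) (x : Fin n → X) : u x = 0 :=
  hu.eq_zero_of_dense ((dense_formCoefficient_ne_zero hη).preimage (isOpenMap_eval j))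
    (fun y hy => (smul_eq_zero.1 (hzero y)).resolve_left hy) x

theorem isHolomorphicSection_of_dense {S : Set (Fin n → X)} (hS : Dense S)
    {Q : (Fin n → X) → (Fin n → X) → F}
    (hQ : ∀ p, ContMDiffAt (productModel n) 𝓘(ℂ, F) ω (Q p) p)
    (hSQ : ∀ p, ∀ᶠ x in 𝓝 p, x ∈ S → localRep Z v p x = Q p x) (hvQ : ∀ p, v p = Q p p) :
    IsHolomorphicSection Z v := by
  refine fun p => (hQ p).congr_of_eventuallyEq ?_
  filter_upwards [eventually_mem_baseSet Z p, (contMDiffAt_iff_contMDiffAt_nhds (by simp)).1 (hQ p),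
    (hSQ p).eventually_nhds] with x hxp hQpx hSQx
  have : (𝓝[S] x).NeBot := mem_closure_iff_nhdsWithin_neBot.1 (hS x)
  have hmem : x ∈ Z.baseSet (Z.indexAt x) ∩ Z.baseSet (Z.indexAt p) := ⟨Z.mem_baseSet_at x, hxp⟩
  -- `v` is not known to be continuous, so its value at `x` is compared with `Q p x` through `Q x`.
  have hcont : ContinuousAt (fun y => Z.coordChange (Z.indexAt x) (Z.indexAt p) y (Q x y)) x :=
    ((Z.continuousOn_coordChange _ _).continuousAt
      (((Z.isOpen_baseSet _).inter (Z.isOpen_baseSet _)).mem_nhds hmem)).clm_apply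
      (hQ x).continuousAt
  rw [localRep, hvQ]
  refine tendsto_nhds_unique_of_eventuallyEq (l := 𝓝[S] x)
    (hcont.mono_left nhdsWithin_le_nhds) (hQpx.continuousAt.mono_left nhdsWithin_le_nhds) ?_
  filter_upwards [self_mem_nhdsWithin, nhdsWithin_le_nhds hSQx, nhdsWithin_le_nhds (hSQ x),
    nhdsWithin_le_nhds (eventually_mem_baseSet Z x),
    nhdsWithin_le_nhds ((Z.isOpen_baseSet _).mem_nhds hxp)] with y hyS hyp hyx hymx hymp
  rw [← hyx hyS, coordChange_localRep Z v hymx hymp, hyp hyS]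

variable [T2Space X]

/-- The transition function of `O(Δ_{j,k})`, at `x`, from the trivialization preferred at `x` to the
one preferred at `p`. For `j = k` the bundle `O(Δ_{j,j})` is the pullback of `TX` by the `j`-th
projection. -/
def diagonalCocycle (j k : Fin n) (p x : Fin n → X) : ℂ :=
  diagonalTransition j k ((diagonalLineBundle X j k).indexAt x)
    ((diagonalLineBundle X j k).indexAt p) x

theorem diagonalCocycle_self (j : Fin n) (p x : Fin n → X) :
    diagonalCocycle j j p x =
      chartChangeDeriv (some (achart ℂ (x j))) (some (achart ℂ (p j))) (x j) := by
  simp [diagonalCocycle, diagonalLineBundle, diagonalTransition]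

theorem diagonalCocycle_of_ne {j k : Fin n} (p : Fin n → X) {x : Fin n → X} (hx : x j ≠ x k) :
    diagonalCocycle j k p x = diagonalEquation j k ((diagonalLineBundle X j k).indexAt p) x := by
  simp [diagonalCocycle, diagonalLineBundle, diagonalTransition, hx, diagonalEquation]

theorem localRep_tensorLine_diagonalLineBundle (Z : VectorBundleCore ℂ (Fin n → X) F κ)
    (u : (Fin n → X) → F) (j k : Fin n) (p x : Fin n → X) :
    localRep (tensorLine Z (diagonalLineBundle X j k)) u p x =
      diagonalCocycle j k p x • localRep Z u p x := by
  simp [localRep, tensorLine, diagonalLineBundle, diagonalCocycle]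

theorem IsHolomorphicSection.formCoefficient_smul {j : Fin n}
    (hu : IsHolomorphicSection (tensorLine Z (diagonalLineBundle X j j)) u)
    (η : HolomorphicOneForm X) :
    IsHolomorphicSection Z fun x => formCoefficient η (x j) • u x := by
  intro p
  have hη := (contMDiffAt_formCoefficient_mul η (p j)).comp p (contMDiff_apply_productModel j p)
  refine (hη.smul (hu p)).congr_of_eventuallyEq ?_
  filter_upwards [(continuous_apply j).continuousAt.eventually
    ((chartAt ℂ (p j)).open_source.mem_nhds (mem_chart_source ℂ (p j)))] with x hx
  have hinv := chartChangeDeriv_mul_chartChangeDeriv (achart ℂ (p j)) (achart ℂ (x j)) hx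
    (mem_chart_source ℂ (x j))
  calc localRep Z (fun y => formCoefficient η (y j) • u y) p x
      = formCoefficient η (x j) • localRep Z u p x := map_smul _ _ _
    _ = (formCoefficient η (x j) * chartChangeDeriv (some (achart ℂ (p j)))
          (some (achart ℂ (x j))) (x j)) •
          localRep (tensorLine Z (diagonalLineBundle X j j)) u p x := by
      rw [localRep_tensorLine_diagonalLineBundle, diagonalCocycle_self, smul_smul, mul_assoc, hinv,
        mul_one]

theorem IsHolomorphicSection.exists_eq_off_diagonal [CompleteSpace F] {j k : Fin n} (hjk : j ≠ k)
    (hu : IsHolomorphicSection (tensorLine Z (diagonalLineBundle X j k)) u)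
    (hzero : ∀ x, x j = x k → u x = 0) :
    ∃ v, IsHolomorphicSection Z v ∧ ∀ x, x j ≠ x k → u x = v x := by
  have hlocal (p x) (hx : x j = x k) :
      localRep (tensorLine Z (diagonalLineBundle X j k)) u p x = 0 := by
    rw [localRep, hzero x hx, map_zero]
  choose Q hQ hQu using fun p =>
    exists_contMDiffAt_eq_diagonalEquation_smul hjk (hu p) (hlocal p)
  have huQ (x) (hx : x j ≠ x k) : u x = Q x x := by
    rw [← localRep_self (tensorLine Z (diagonalLineBundle X j k)) u x, (hQu x).self_of_nhds]
    simp [diagonalLineBundle, hx, diagonalEquation]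
  refine ⟨fun x => Q x x, isHolomorphicSection_of_dense (dense_setOf_apply_ne_apply hjk) hQ
    (fun p => ?_) fun _ => rfl, huQ⟩
  filter_upwards [hQu p, eventually_mem_baseSet (diagonalLineBundle X j k) p] with x hx hxp hxjk
  rw [localRep_tensorLine_diagonalLineBundle, diagonalCocycle_of_ne p hxjk] at hx
  rw [localRep, ← huQ x hxjk]
  exact smul_right_injective F (diagonalEquation_ne_zero j k _ hxp hxjk) hx

end HolomorphicSections

section CanonicalSection

variable {X : Type*} {n : ℕ} {D : Multiset (Fin n × Fin n)} {d : Fin n × Fin n} {x : Fin n → X}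

/-- The canonical section of `diagonalBundle X D`, whose divisor is the sum of the diagonals in `D`.
Away from the diagonals the preferred trivialization is given by the local equation `1`, so the
value is `1`. The section is zero as soon as `D` contains a pair `(j, j)`. -/
def canonicalSection (D : Multiset (Fin n × Fin n)) (x : Fin n → X) : ℂ :=
  open Classical in (D.map fun d => if x d.1 = x d.2 then 0 else 1).prod

theorem canonicalSection_eq_zero (hd : d ∈ D) (hx : x d.1 = x d.2) : canonicalSection D x = 0 :=
  Multiset.prod_eq_zero (Multiset.mem_map.2 ⟨d, hd, if_pos hx⟩)

theorem canonicalSection_eq_one (hx : ∀ d ∈ D, x d.1 ≠ x d.2) : canonicalSection D x = 1 :=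
  Multiset.prod_eq_one fun _ hc => by
    obtain ⟨d, hd, rfl⟩ := Multiset.mem_map.1 hc
    exact if_neg (hx d hd)

theorem canonicalSection_cons_of_ne (hx : x d.1 ≠ x d.2) :
    canonicalSection (d ::ₘ D) x = canonicalSection D x := by
  simp [canonicalSection, hx]

end CanonicalSection

section DiagonalDivisors

variable {X : Type*} [TopologicalSpace X] [ChartedSpace ℂ X] [T2Space X] [IsManifold 𝓘(ℂ) ω X]
  {n l : ℕ}

variable (X) in
/-- The line bundle `⨂ O(Δ_{j,k})` over the pairs `(j, k)` of the multiset `D`. Pairs with `j = k`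
are allowed and contribute the pullback of `TX` by the `j`-th projection. -/
def diagonalBundle (D : Multiset (Fin n × Fin n)) :
    VectorBundleCore ℂ (Fin n → X) ℂ (Fin n × Fin n → Option (atlas ℂ X)) :=
  tensorPowers (fun d => diagonalLineBundle X d.1 d.2) D.count

theorem localRep_diagonalBundle (D : Multiset (Fin n × Fin n)) (u : (Fin n → X) → ℂ)
    (p x : Fin n → X) :
    localRep (diagonalBundle X D) u p x =
      (D.map fun d => diagonalCocycle d.1 d.2 p x).prod * u x := by
  have hcount (d) (hd : d ∉ D.toFinset) : diagonalCocycle d.1 d.2 p x ^ D.count d = 1 := by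
    rw [Multiset.count_eq_zero.2 (Multiset.mem_toFinset.not.1 hd), pow_zero]
  rw [Finset.prod_multiset_map_count,
    Finset.prod_subset (Finset.subset_univ D.toFinset) fun d _ => hcount d]
  simp [localRep, diagonalBundle, tensorPowers, diagonalLineBundle, diagonalCocycle]

theorem isHolomorphicSection_diagonalBundle_cons {D : Multiset (Fin n × Fin n)} {j k : Fin n}
    {u : (Fin n → X) → ℂ} :
    IsHolomorphicSection (diagonalBundle X ((j, k) ::ₘ D)) u ↔
      IsHolomorphicSection (tensorLine (diagonalBundle X D) (diagonalLineBundle X j k)) u := by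
  have h (p) : localRep (diagonalBundle X ((j, k) ::ₘ D)) u p =
      localRep (tensorLine (diagonalBundle X D) (diagonalLineBundle X j k)) u p := by
    funext x
    rw [localRep_tensorLine_diagonalLineBundle, localRep_diagonalBundle, localRep_diagonalBundle,
      Multiset.map_cons, Multiset.prod_cons, mul_assoc, smul_eq_mul]
  simp only [IsHolomorphicSection, h]

theorem diagonalCocycle_comp (σ : Fin n → Fin l) (j k : Fin n) (p x : Fin l → X) :
    diagonalCocycle j k (p ∘ σ) (x ∘ σ) = diagonalCocycle (σ j) (σ k) p x := by
  have hequation (a : Option (atlas ℂ X)) :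
      diagonalEquation j k a (x ∘ σ) = diagonalEquation (σ j) (σ k) a x := by cases a <;> rfl
  simp only [diagonalCocycle, diagonalTransition, hequation]
  rfl

theorem IsHolomorphicSection.reindex {D : Multiset (Fin n × Fin n)} {u : (Fin n → X) → ℂ}
    (hu : IsHolomorphicSection (diagonalBundle X D) u) (σ : Fin n → Fin l) :
    IsHolomorphicSection (diagonalBundle X (D.map (Prod.map σ σ))) fun x => u (x ∘ σ) := by
  intro p
  refine ((hu (p ∘ σ)).comp p (contMDiff_reindex σ p)).congr_of_eventuallyEq ?_
  refine .of_forall fun x => ?_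
  rw [Function.comp_apply, localRep_diagonalBundle, localRep_diagonalBundle, Multiset.map_map]
  simp only [Function.comp_def, Prod.map, ← diagonalCocycle_comp]

theorem IsHolomorphicSection.exists_eq_mul_canonicalSection_zero [CompactSpace X]
    [ConnectedSpace X] {u : (Fin n → X) → ℂ} (hu : IsHolomorphicSection (diagonalBundle X 0) u) :
    ∃ c, ∀ x, u x = c * canonicalSection 0 x := by
  obtain ⟨c, hc⟩ := exists_eq_const_of_contMDiff (f := u) fun p =>
    (hu p).congr_of_eventuallyEq (.of_forall fun x => by simp [localRep_diagonalBundle])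
  exact ⟨c, fun x => by simp [canonicalSection, hc]⟩

end DiagonalDivisors

section SectionsOfDiagonalBundles

variable {X : Type*} [TopologicalSpace X] [ChartedSpace ℂ X] [T2Space X] [IsManifold 𝓘(ℂ) ω X]
  {n : ℕ} {D : Multiset (Fin n × Fin n)} {u : (Fin n → X) → ℂ}

theorem IsHolomorphicSection.eq_zero_of_apply_eq {D : Multiset (Fin (n + 1) × Fin (n + 1))}
    {u : (Fin (n + 1) → X) → ℂ} {j k : Fin (n + 1)} (hjk : j ≠ k)
    (hu : IsHolomorphicSection (diagonalBundle X ((j, k) ::ₘ D)) u)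
    (hn : ∀ (D : Multiset (Fin n × Fin n)) w, IsHolomorphicSection (diagonalBundle X D) w →
      ∃ c, ∀ x, w x = c * canonicalSection D x) {x : Fin (n + 1) → X} (hx : x j = x k) :
    u x = 0 := by
  obtain ⟨i, rfl⟩ := Fin.exists_succAbove_eq hjk
  let σ : Fin (n + 1) → Fin n := k.insertNth i id
  have hxσ : (fun a => x (k.succAbove a)) ∘ σ = x := by
    funext a
    induction a using k.succAboveCases <;> simp [σ, hx]
  have hσ : σ (k.succAbove i) = σ k := by simp [σ]
  obtain ⟨c, hc⟩ := hn _ _ (hu.reindex σ)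
  rw [← hxσ, hc, canonicalSection_eq_zero (d := (σ (k.succAbove i), σ k)) (by simp)
    (by rw [hσ]), mul_zero]

variable [ConnectedSpace X]

theorem IsHolomorphicSection.eq_zero_of_cons_self {j : Fin n} {η : HolomorphicOneForm X}
    (hη : η ≠ 0) {q : X} (hq : formCoefficient η q = 0)
    (hu : IsHolomorphicSection (diagonalBundle X ((j, j) ::ₘ D)) u)
    (hD : ∀ w, IsHolomorphicSection (diagonalBundle X D) w →
      ∃ c, ∀ x, w x = c * canonicalSection D x) (x : Fin n → X) : u x = 0 := by
  obtain ⟨c, hc⟩ := hD _ ((isHolomorphicSection_diagonalBundle_cons.1 hu).formCoefficient_smul η)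
  refine hu.eq_zero_of_forall_formCoefficient_smul (j := j) hη (fun y => ?_) x
  rw [hc]
  by_cases hself : ∃ d ∈ D, d.1 = d.2
  · obtain ⟨d, hd, hd'⟩ := hself
    rw [canonicalSection_eq_zero hd (congrArg y hd'), mul_zero]
  · have := infinite_of_chartedSpace (X := X)
    obtain ⟨z, hz, hzj⟩ := exists_injective_apply_eq j q
    have hcz := hc z
    rw [canonicalSection_eq_one fun d hd => hz.ne fun h => hself ⟨d, hd, h⟩, hzj, hq, zero_smul,
      mul_one] at hcz
    rw [← hcz, zero_mul]

theorem IsHolomorphicSection.exists_eq_mul_canonicalSection [CompactSpace X]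
    {η : HolomorphicOneForm X} (hη : η ≠ 0) {q : X} (hq : formCoefficient η q = 0)
    (hu : IsHolomorphicSection (diagonalBundle X D) u) :
    ∃ c, ∀ x, u x = c * canonicalSection D x := by
  induction n with
  | zero =>
    induction D using Multiset.induction with
    | empty => exact hu.exists_eq_mul_canonicalSection_zero
    | cons d => exact d.1.elim0
  | succ n ihn =>
    induction D using Multiset.induction generalizing u with
    | empty => exact hu.exists_eq_mul_canonicalSection_zero
    | cons d D ihD =>
      obtain ⟨j, k⟩ := d
      rcases eq_or_ne j k with rfl | hjk
      · refine ⟨0, fun x => ?_⟩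
        rw [hu.eq_zero_of_cons_self hη hq (fun _ => ihD), zero_mul]
      · have hdiag (x) (hx : x j = x k) : u x = 0 :=
          hu.eq_zero_of_apply_eq hjk (fun _ _ => ihn) hx
        obtain ⟨v, hv, huv⟩ :=
          (isHolomorphicSection_diagonalBundle_cons.1 hu).exists_eq_off_diagonal hjk hdiag
        obtain ⟨c, hc⟩ := ihD hv
        refine ⟨c, fun x => ?_⟩
        by_cases hx : x j = x k
        · rw [hdiag x hx, canonicalSection_eq_zero (Multiset.mem_cons_self _ _) hx, mul_zero]
        · rw [huv x hx, hc, canonicalSection_cons_of_ne hx]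

end SectionsOfDiagonalBundles

section TwistedTangentBundle

variable {X : Type*} [TopologicalSpace X] [ChartedSpace ℂ X] [IsManifold 𝓘(ℂ) ω X] {n : ℕ}

theorem tangentCoordChange_apply_eq (p x : Fin n → X) (hx : ∀ i, x i ∈ (chartAt ℂ (p i)).source)
    (v : Fin n → ℂ) (i : Fin n) :
    (tangentBundleCore (productModel n) (Fin n → X)).coordChange (achart _ x) (achart _ p) x v i =
      chartChangeDeriv (some (achart ℂ (x i))) (some (achart ℂ (p i))) (x i) * v i := by
  have hderiv (i) : HasFDerivAt
      (fun z : Fin n → ℂ => (chartAt ℂ (p i) ∘ (chartAt ℂ (x i)).symm) (z i))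
      (chartChangeDeriv (some (achart ℂ (x i))) (some (achart ℂ (p i))) (x i) •
        ContinuousLinearMap.proj (R := ℂ) (φ := fun _ : Fin n => ℂ) i)
      (extChartAt (productModel n) x x) :=
    (analyticAt_chartChange (achart ℂ (x i)) (achart ℂ (p i)) (mem_chart_source ℂ (x i))
      (hx i)).differentiableAt.hasDerivAt.comp_hasFDerivAt (f := fun z : Fin n → ℂ => z i)
        (extChartAt (productModel n) x x) (hasFDerivAt_apply i _)
  rw [tangentBundleCore_coordChange_achart, ModelWithCorners.range_eq_univ, fderivWithin_univ]
  exact congrFun (congrArg (· v) (hasFDerivAt_pi.2 hderiv).fderiv) i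

variable [T2Space X]

/-- The multiset of pairs in which `(j, k)` occurs `m_{j,k}` times. -/
def pairMultiset (m : DiagonalPair n → ℕ) : Multiset (Fin n × Fin n) :=
  ∑ d, m d • {d.1}

theorem localRep_twistedTangentBundle (m : DiagonalPair n → ℕ) (s : (Fin n → X) → Fin n → ℂ)
    {p x : Fin n → X} (hx : ∀ i, x i ∈ (chartAt ℂ (p i)).source) (i : Fin n) :
    localRep (twistedTangentBundle X m) s p x i =
      localRep (diagonalBundle X ((i, i) ::ₘ pairMultiset m)) (fun y => s y i) p x := by
  have hprod : ((pairMultiset m).map fun d => diagonalCocycle d.1 d.2 p x).prod =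
      ∏ d, diagonalCocycle d.1.1 d.1.2 p x ^ m d := by
    rw [pairMultiset, ← Multiset.coe_mapAddMonoidHom, map_sum, Multiset.prod_sum]
    simp [Multiset.map_nsmul, Multiset.prod_nsmul]
  have hdivisor : (diagonalDivisorBundle X m).coordChange ((diagonalDivisorBundle X m).indexAt x)
      ((diagonalDivisorBundle X m).indexAt p) x 1 = ∏ d, diagonalCocycle d.1.1 d.1.2 p x ^ m d := by
    simp [diagonalDivisorBundle, tensorPowers, diagonalLineBundle, diagonalCocycle]
  calc localRep (twistedTangentBundle X m) s p x i
      = (diagonalDivisorBundle X m).coordChange ((diagonalDivisorBundle X m).indexAt x)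
          ((diagonalDivisorBundle X m).indexAt p) x 1 *
        (tangentBundleCore (productModel n) (Fin n → X)).coordChange (achart _ x) (achart _ p) x
          (s x) i := rfl
    _ = (∏ d, diagonalCocycle d.1.1 d.1.2 p x ^ m d) * (diagonalCocycle i i p x * s x i) := by
      rw [hdivisor, tangentCoordChange_apply_eq p x hx, diagonalCocycle_self]
    _ = _ := by
      rw [localRep_diagonalBundle, Multiset.map_cons, Multiset.prod_cons, hprod]
      ring

theorem IsHolomorphicSection.apply {m : DiagonalPair n → ℕ} {s : (Fin n → X) → Fin n → ℂ}
    (hs : IsHolomorphicSection (twistedTangentBundle X m) s) (i : Fin n) :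
    IsHolomorphicSection (diagonalBundle X ((i, i) ::ₘ pairMultiset m)) fun x => s x i := by
  intro p
  refine (contMDiffAt_pi_space.1 (hs p) i).congr_of_eventuallyEq ?_
  filter_upwards [Filter.eventually_all.2 fun i => (continuous_apply i).continuousAt.eventually
    ((chartAt ℂ (p i)).open_source.mem_nhds (mem_chart_source ℂ (p i)))] with x hx
  exact (localRep_twistedTangentBundle m s hx i).symm

end TwistedTangentBundle

end

theorem proposition2p3 (X : Type*) [TopologicalSpace X] [T2Space X] [CompactSpace X]
    [ConnectedSpace X] [ChartedSpace ℂ X] [IsManifold 𝓘(ℂ) ω X] (hg : 2 ≤ genus X)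
    (n : ℕ) (hn : 1 ≤ n) (m : DiagonalPair n → ℕ)
    (s : Cₛ^ω⟮productModel n; Fin n → ℂ, (twistedTangentBundle X m).Fiber⟯) :
    s = 0 := by
  obtain ⟨q⟩ := (inferInstance : Nonempty X)
  obtain ⟨η, hη, hq⟩ := exists_oneForm_ne_zero_apply_eq_zero hg q
  ext x
  funext i
  obtain ⟨c, hc⟩ :=
    ((isHolomorphicSection_coe s).apply i).exists_eq_mul_canonicalSection hη hq
  exact (hc x).trans <| mul_eq_zero_of_right c <|
    canonicalSection_eq_zero (Multiset.mem_cons_self (i, i) (pairMultiset m)) rfl
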